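/- Let $(X,d)$ be a metric space. A geodesic joining $x,y\in X$ is a map $\gamma:[0,l]\to X$, $l\ge 0$, with $\gamma(0)=x$, $\gamma(l)=y$ and $d(\gamma(s),\gamma(t))=|s-t|$ for all $s,t\in[0,l]$; its image is a geodesic segment joining $x$ and $y$. The space $X$ is called geodesic (uniquely geodesic) if every two points are joined by a geodesic (by exactly one geodesic); in a uniquely geodesic space $[x,y]$ denotes the geodesic segment joining $x$ and $y$. For $\kappa\in\mathbb R$ let $M_\kappa^2$ be the complete simply connected Riemannian surface of constant curvature $\kappa$, with distance $d_\kappa$ and diameter $D_\kappa$ (so $D_\kappa=\infty$ if $\kappa\le 0$ and $D_\kappa=\pi/\sqrt\kappa$ if $\kappa>0$). A geodesic space $X$ has curvature bounded below by $\kappa$ (in the sense of Alexandrov) if for every geodesic triangle $\Delta$ in $X$ (three vertices $x_1,x_2,x_3$ and three geodesic segments joining them pairwise) of perimeter less than $2D_\kappa$, every comparison triangle of $\Delta$ in $M_\kappa^2$ (a triangle with vertices $\bar x_1,\bar x_2,\bar x_3$ such that $d_\kappa(\bar x_i,\bar x_j)=d(x_i,x_j)$ for all $i,j$) and all points $x,y$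 on the sides of $\Delta$, one has $d(x,y)\ge d_\kappa(\bar x,\bar y)$, where $\bar x,\bar y$ are comparison points of $x,y$: if $x$ lies on the side joining $x_i$ and $x_j$, then $\bar x$ lies on the side joining $\bar x_i$ and $\bar x_j$ and $d_\kappa(\bar x_i,\bar x)=d(x_i,x)$. The space $X$ has curvature bounded below if this holds for some $\kappa\in\mathbb R$. A topological ray in $X$ is a subset of $X$ homeomorphic to $[0,\infty)$; it is closed if it is a closed subset of $X$. A polygonal ray is a closed topological ray $L$ for which there are a homeomorphism $h:[0,\infty)\to L$ and an unbounded sequence $0=v_0<v_1<v_2<\cdots$ of real numbers such that $h([v_n,v_{n+1}])$ is a geodesic segment for every $n\ge 0$. In a uniquely geodesic space, a polygonal ray $L$ is inscribed in a topological ray $\Gamma$ if there is a sequence $(a_n)_{n\ge 0}$ of points of $\Gamma$ such that $L=\bigcup_{n\ge 0}[a_n,a_{n+1}]$. **Proposition.** Let $X$ be a complete, uniquely geodesic space of curvature bounded below, and let $\Gamma\subseteq X$ be a closed topological ray. Then there exists a polygonal ray inscribed in $\Gamma$. -/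

import Mathlib

open scoped UpperHalfPlane

namespace GeodesicRay

section Geodesics

variable {X : Type*} [MetricSpace X]

/-- `γ`, restricted to `[0, l]`, is a geodesic joining `x` and `y`
(values of `γ` outside `[0, l]` play no role). -/
structure IsGeodesic (γ : ℝ → X) (l : ℝ) (x y : X) : Prop where
  length_nonneg : 0 ≤ l
  map_zero : γ 0 = x
  map_length : γ l = y
  dist_eq : ∀ s ∈ Set.Icc 0 l, ∀ t ∈ Set.Icc 0 l, dist (γ s) (γ t) = |s - t|

/-- `S` is a geodesic segment joining `x` and `y`: the image of a geodesic joining them. -/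
def IsGeodesicSegment (x y : X) (S : Set X) : Prop :=
  ∃ (γ : ℝ → X) (l : ℝ), IsGeodesic γ l x y ∧ S = γ '' Set.Icc 0 l

variable (X) in
/-- Every two points are joined by a geodesic. -/
def IsGeodesicSpace : Prop :=
  ∀ x y : X, ∃ (γ : ℝ → X) (l : ℝ), IsGeodesic γ l x y

variable (X) in
/-- Every two points are joined by exactly one geodesic. (The length `l` of a geodesic joining
`x` and `y` is necessarily `dist x y`, so two such geodesics always have the same domain.) -/
def IsUniquelyGeodesicSpace : Prop :=
  IsGeodesicSpace X ∧
    ∀ (x y : X) (l : ℝ) (γ γ' : ℝ → X), IsGeodesic γ l x y → IsGeodesic γ' l x y →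
      Set.EqOn γ γ' (Set.Icc 0 l)

/-- The segment `[x, y]`: in a uniquely geodesic space there is exactly one geodesic segment
joining `x` and `y`, and this is that segment. -/
def segment (x y : X) : Set X :=
  ⋃₀ {S | IsGeodesicSegment x y S}

end Geodesics

section ModelPlanes

/-- The Euclidean plane, the model plane of curvature `0`. -/
abbrev EuclideanModel : Type := EuclideanSpace ℝ (Fin 2)

/-- The unit sphere in Euclidean `3`-space, underlying the model planes of positive curvature. -/
abbrev SphereModel : Type := Metric.sphere (0 : EuclideanSpace ℝ (Fin 3)) 1

/-- The distance of the model plane of curvature `κ > 0`: the angular (great-circle) distance of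
the unit sphere, multiplied by `1 / √κ`. -/
noncomputable def sphereDist (κ : ℝ) (p q : SphereModel) : ℝ :=
  InnerProductGeometry.angle (p : EuclideanSpace ℝ (Fin 3)) (q : EuclideanSpace ℝ (Fin 3)) / √κ

/-- The distance of the model plane of curvature `κ < 0`: the distance of the hyperbolic plane
(of curvature `-1`, as the Poincaré upper half-plane), multiplied by `1 / √(-κ)`. -/
noncomputable def hyperbolicDist (κ : ℝ) (p q : ℍ) : ℝ :=
  dist p q / √(-κ)

/-- The diameter `D_κ` of the model plane of curvature `κ`. -/
noncomputable def modelDiam (κ : ℝ) : ENNReal :=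
  if κ ≤ 0 then ⊤ else ENNReal.ofReal (Real.pi / √κ)

end ModelPlanes

section Comparison

/-- A geodesic triangle: three vertices and three geodesic segments; the side with index `i` is
the one opposite to the vertex `i` (indices modulo `3`). -/
structure GeodesicTriangle (X : Type*) [MetricSpace X] where
  vertex : Fin 3 → X
  side : Fin 3 → Set X
  isSegment : ∀ i, IsGeodesicSegment (vertex (i + 1)) (vertex (i + 2)) (side i)

variable {X : Type*} [MetricSpace X] {M : Type*}

/-- The perimeter of a geodesic triangle. -/
noncomputable def GeodesicTriangle.perimeter (T : GeodesicTriangle X) : ℝ :=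
  ∑ i, dist (T.vertex (i + 1)) (T.vertex (i + 2))

/-- `q` are the vertices of a comparison triangle of `T` in `M`, where `dM` is the distance
of `M`. -/
def IsComparisonTriangle (dM : M → M → ℝ) (T : GeodesicTriangle X) (q : Fin 3 → M) : Prop :=
  ∀ i j, dM (q i) (q j) = dist (T.vertex i) (T.vertex j)

/-- `x'` is the comparison point of the point `x` of the side `i` of `T`. As `x` lies on a geodesic
joining the endpoints of that side, `x'` divides the distance of the corresponding vertices of the
comparison triangle in the same way, that is, `x'` lies on the corresponding side, at the
distance from its endpoints that `x` has. -/
def IsComparisonPoint (dM : M → M → ℝ) (T : GeodesicTriangle X) (q : Fin 3 → M)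
    (i : Fin 3) (x : X) (x' : M) : Prop :=
  dM (q (i + 1)) x' = dist (T.vertex (i + 1)) x ∧
    dM x' (q (i + 2)) = dist x (T.vertex (i + 2))

/-- The triangle `T` satisfies the reverse of the `CAT` inequality with respect to `M`:
distances between points of `T` are at least the distances between their comparison points. -/
def SatisfiesReverseCAT (dM : M → M → ℝ) (T : GeodesicTriangle X) : Prop :=
  ∀ q : Fin 3 → M, IsComparisonTriangle dM T q →
    ∀ i j : Fin 3, ∀ x ∈ T.side i, ∀ y ∈ T.side j, ∀ x' y' : M,
      IsComparisonPoint dM T q i x x' → IsComparisonPoint dM T q j y y' →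
        dM x' y' ≤ dist x y

variable (X) in
/-- `X` is a geodesic space of curvature bounded below by `κ` in the sense of Alexandrov. -/
def CurvatureBoundedBelowBy (κ : ℝ) : Prop :=
  IsGeodesicSpace X ∧
    ∀ T : GeodesicTriangle X, ENNReal.ofReal T.perimeter < 2 * modelDiam κ →
      (κ < 0 → SatisfiesReverseCAT (hyperbolicDist κ) T) ∧
      (κ = 0 → SatisfiesReverseCAT (fun p q : EuclideanModel => dist p q) T) ∧
      (0 < κ → SatisfiesReverseCAT (sphereDist κ) T)

variable (X) in
/-- `X` is a geodesic space of curvature bounded below (by some real number). -/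
def CurvatureBoundedBelow : Prop :=
  ∃ κ : ℝ, CurvatureBoundedBelowBy X κ

end Comparison

section Rays

variable {X : Type*} [MetricSpace X]

/-- A topological ray: a homeomorphic image of `[0, ∞)`. -/
def IsTopologicalRay (Γ : Set X) : Prop :=
  Nonempty (Set.Ici (0 : ℝ) ≃ₜ Γ)

/-- A polygonal ray: a closed topological ray `L` with a homeomorphism `h` from `[0, ∞)` onto `L`
and an unbounded sequence `0 = v 0 < v 1 < v 2 < …` such that `h` maps each `[v n, v (n + 1)]`
onto a geodesic segment. -/
def IsPolygonalRay (L : Set X) : Prop :=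
  IsClosed L ∧
    ∃ (h : Set.Ici (0 : ℝ) ≃ₜ L) (v : ℕ → ℝ),
      v 0 = 0 ∧ StrictMono v ∧ ¬ BddAbove (Set.range v) ∧
        ∀ n, ∃ x y : X, IsGeodesicSegment x y
          ((fun t : Set.Ici (0 : ℝ) => (h t : X)) '' {t | (t : ℝ) ∈ Set.Icc (v n) (v (n + 1))})

/-- The polygonal ray `L` is inscribed in `Γ`: it is the union of the segments joining the
consecutive terms of a sequence of points of `Γ`. -/
def IsInscribedIn (L Γ : Set X) : Prop :=
  ∃ a : ℕ → X, (∀ n, a n ∈ Γ) ∧ L = ⋃ n, segment (a n) (a (n + 1))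

end Rays

end GeodesicRay

/-!
The curvature bound enters through one consequence only: geodesics do not branch
(`IsGeodesic.eq_of_eq`). If two geodesics from `q` had a common midpoint `m` and distinct endpoints
`p`, `p'`, then in the comparison triangle of `q, p, p'` the comparison points of `m` on the two
legs would be distinct, although both sit over `m`; this contradicts the reverse `CAT` inequality.
The comparison triangles are written down in polar coordinates of each model plane. It follows that
two sides `[p, q]` and `[q, s]` of a triangle whose third side is the longest meet in `q` only
(`eq_of_mem_segment_of_mem_segment`).

Parametrize the closed ray as `g : [0, ∞) → X`. As `g` is a closed embedding, there is a positive
antitone function `ρ`, tending to `0`, such that `d (g s) (g u) > ρ s` whenever `u ≥ s + 2`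
(`exists_antitone_gauge`). Choose the vertices `a n = g (τ n)` greedily: `a (n + 1)` is the last
point of the ray with `d (a n) (a (n + 1)) ≤ ρ (τ n)` (`exists_greedy_subdivision`). Later vertices
are then further away: `d (a i) (a j) > ρ (τ i)` for `j > i + 1`. If `[a i, a (i + 1)]` met
`[a j, a (j + 1)]` for some `j > i + 1`, the triangle inequality would give
`d (a i) (a j) + d (a (i + 1)) (a (j + 1)) ≤ ρ (τ i) + ρ (τ j) ≤ ρ (τ i) + ρ (τ (i + 1))`, which is
less than the left-hand side. Consecutive segments meet in their common vertex only, since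
`d (a n) (a (n + 2))` exceeds the lengths of both. As `ρ (τ n)` tends to `0` and the `a n` leave
every small ball, the segments are locally finite, so their union is a polygonal ray
(`isPolygonalRay_iUnion_segment`).
-/

open Filter Topology

namespace GeodesicRay

/-! ### Isosceles triangles in the model planes -/

/-- In the distance `dM` there are isosceles triangles with legs `2 * δ` and any base
`c ∈ (0, 2 * δ]`, having legs whose midpoints `m` and `m'` are distinct. -/
def HasSeparatedMidpoints {M : Type*} (dM : M → M → ℝ) (δ : ℝ) : Prop :=
  ∀ c : ℝ, 0 < c → c ≤ 2 * δ → ∃ q p p' m m' : M,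
    dM q p = 2 * δ ∧ dM q p' = 2 * δ ∧ dM p p' = c ∧
    dM q m = δ ∧ dM m p = δ ∧ dM q m' = δ ∧ dM m' p' = δ ∧ 0 < dM m m'

theorem hasSeparatedMidpoints_euclidean {δ : ℝ} (hδ : 0 < δ) :
    HasSeparatedMidpoints (fun p q : EuclideanModel => dist p q) δ := by
  intro c hc hcδ
  -- the triangle has its apex at the origin and is symmetric about the first axis
  have hsq : (0 : ℝ) ≤ 4 * δ ^ 2 - (c / 2) ^ 2 := by nlinarith
  obtain ⟨h, hh⟩ : ∃ h : ℝ, h ^ 2 = 4 * δ ^ 2 - (c / 2) ^ 2 :=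
    ⟨√(4 * δ ^ 2 - (c / 2) ^ 2), Real.sq_sqrt hsq⟩
  have key : ∀ a b a' b' d : ℝ, 0 ≤ d → (a - a') ^ 2 + (b - b') ^ 2 = d ^ 2 →
      dist (!₂[a, b] : EuclideanModel) !₂[a', b'] = d := by
    intro a b a' b' d hd h
    rw [EuclideanSpace.dist_eq]
    simp only [Fin.sum_univ_two, Real.dist_eq, sq_abs]
    simp only [Matrix.cons_val_zero, Matrix.cons_val_one]
    rw [h, Real.sqrt_sq hd]
  refine ⟨!₂[0, 0], !₂[h, c / 2], !₂[h, -(c / 2)], !₂[h / 2, c / 4], !₂[h / 2, -(c / 4)],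
    ?_, ?_, ?_, ?_, ?_, ?_, ?_, ?_⟩
  · apply key <;> nlinarith
  · apply key <;> nlinarith
  · apply key <;> nlinarith
  · apply key <;> nlinarith
  · apply key <;> nlinarith
  · apply key <;> nlinarith
  · apply key <;> nlinarith
  · have : dist (!₂[h / 2, c / 4] : EuclideanModel) !₂[h / 2, -(c / 4)] = c / 2 := by
      apply key <;> nlinarith
    simp only [this]
    linarith

/-- The point of the unit sphere with polar coordinates `r` (distance from the north pole) and
`(x, y)` (direction). -/
noncomputable def spherePolar (r x y : ℝ) (h : x ^ 2 + y ^ 2 = 1) : SphereModel :=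
  ⟨!₂[x * Real.sin r, y * Real.sin r, Real.cos r], by
    rw [mem_sphere_zero_iff_norm, EuclideanSpace.norm_eq, Real.sqrt_eq_one]
    simp only [Fin.sum_univ_three, Real.norm_eq_abs, sq_abs]
    simp only [Matrix.cons_val_zero, Matrix.cons_val_one, Matrix.cons_val]
    linear_combination (Real.sin r) ^ 2 * h + Real.sin_sq_add_cos_sq r⟩

/-- The spherical law of cosines. -/
theorem angle_spherePolar (r x y r' x' y' : ℝ) (h : x ^ 2 + y ^ 2 = 1) (h' : x' ^ 2 + y' ^ 2 = 1) :
    InnerProductGeometry.angle (spherePolar r x y h : EuclideanSpace ℝ (Fin 3))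
        (spherePolar r' x' y' h' : EuclideanSpace ℝ (Fin 3)) =
      Real.arccos (Real.cos r * Real.cos r' + Real.sin r * Real.sin r' * (x * x' + y * y')) := by
  have h1 := mem_sphere_zero_iff_norm.1 (spherePolar r x y h).2
  have h2 := mem_sphere_zero_iff_norm.1 (spherePolar r' x' y' h').2
  rw [InnerProductGeometry.angle, h1, h2]
  congr 1
  rw [spherePolar, spherePolar, PiLp.inner_apply]
  simp only [Fin.sum_univ_three]
  simp
  ring

theorem sphereDist_spherePolar {κ d : ℝ} (hκ : 0 < κ) {r x y r' x' y' : ℝ}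
    (h : x ^ 2 + y ^ 2 = 1) (h' : x' ^ 2 + y' ^ 2 = 1) (hd : 0 ≤ d) (hdπ : d * √κ ≤ Real.pi)
    (e : Real.cos r * Real.cos r' + Real.sin r * Real.sin r' * (x * x' + y * y') =
      Real.cos (d * √κ)) :
    sphereDist κ (spherePolar r x y h) (spherePolar r' x' y' h') = d := by
  have hs : 0 < √κ := Real.sqrt_pos.2 hκ
  rw [sphereDist, angle_spherePolar, e, Real.arccos_cos (by positivity) hdπ]
  field_simp

theorem hasSeparatedMidpoints_sphere {κ δ : ℝ} (hκ : 0 < κ) (hδ : 0 < δ)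
    (hδκ : 2 * δ * √κ ≤ Real.pi / 2) :
    HasSeparatedMidpoints (sphereDist κ) δ := by
  intro c hc hcδ
  have hs : 0 < √κ := Real.sqrt_pos.2 hκ
  have hπ := Real.pi_pos
  have hδs : 0 < δ * √κ := by positivity
  have hcs : 0 < c * √κ := by positivity
  have hcs' : c * √κ ≤ 2 * δ * √κ := by gcongr
  have hsin : 0 < Real.sin (2 * δ * √κ) := Real.sin_pos_of_pos_of_lt_pi (by linarith) (by linarith)
  have hsin1 : 0 < Real.sin (δ * √κ) := Real.sin_pos_of_pos_of_lt_pi (by linarith) (by linarith)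
  have hsinc : 0 < Real.sin (c * √κ / 2) :=
    Real.sin_pos_of_pos_of_lt_pi (by linarith) (by linarith)
  have hle : Real.sin (c * √κ / 2) ≤ Real.sin (2 * δ * √κ) :=
    Real.sin_le_sin_of_le_of_le_pi_div_two (by linarith) (by linarith) (by linarith)
  -- half of the triangle is right-angled, which determines its angle at `q`
  obtain ⟨y, hy0, hy1, hy⟩ : ∃ y : ℝ, 0 < y ∧ y ≤ 1 ∧
      y * Real.sin (2 * δ * √κ) = Real.sin (c * √κ / 2) :=
    ⟨Real.sin (c * √κ / 2) / Real.sin (2 * δ * √κ), by positivity, (div_le_one hsin).2 hle,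
      div_mul_cancel₀ _ hsin.ne'⟩
  obtain ⟨x, hx⟩ : ∃ x : ℝ, x ^ 2 = 1 - y ^ 2 := ⟨√(1 - y ^ 2), Real.sq_sqrt (by nlinarith)⟩
  have hxy : x ^ 2 + y ^ 2 = 1 := by linarith
  have hxy' : x ^ 2 + (-y) ^ 2 = 1 := by linarith
  have h10 : (1 : ℝ) ^ 2 + 0 ^ 2 = 1 := by norm_num
  have hdir : x * x + y * y = 1 := by linarith
  have hdir' : x * x + -y * -y = 1 := by linarith
  have htwo : 2 * δ * √κ = δ * √κ + δ * √κ := by ring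
  refine ⟨spherePolar 0 1 0 h10, spherePolar (2 * δ * √κ) x y hxy,
    spherePolar (2 * δ * √κ) x (-y) hxy', spherePolar (δ * √κ) x y hxy,
    spherePolar (δ * √κ) x (-y) hxy', ?_, ?_, ?_, ?_, ?_, ?_, ?_, ?_⟩
  · exact sphereDist_spherePolar hκ _ _ (by linarith) (by linarith) (by simp)
  · exact sphereDist_spherePolar hκ _ _ (by linarith) (by linarith) (by simp)
  · refine sphereDist_spherePolar hκ _ _ hc.le (by linarith) ?_
    have h2 : Real.cos (c * √κ) = 1 - 2 * Real.sin (c * √κ / 2) ^ 2 := by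
      rw [show c * √κ = 2 * (c * √κ / 2) by ring, Real.cos_two_mul, Real.cos_sq']
      ring_nf
    rw [h2, ← hy]
    linear_combination Real.sin_sq_add_cos_sq (2 * δ * √κ) + Real.sin (2 * δ * √κ) ^ 2 * hx
  · exact sphereDist_spherePolar hκ _ _ hδ.le (by linarith) (by simp)
  · refine sphereDist_spherePolar hκ _ _ hδ.le (by linarith) ?_
    rw [hdir, mul_one, htwo, ← Real.cos_sub]
    rw [sub_add_cancel_left, Real.cos_neg]
  · exact sphereDist_spherePolar hκ _ _ hδ.le (by linarith) (by simp)
  · refine sphereDist_spherePolar hκ _ _ hδ.le (by linarith) ?_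
    rw [hdir', mul_one, htwo, ← Real.cos_sub]
    rw [sub_add_cancel_left, Real.cos_neg]
  · refine div_pos ?_ hs
    rw [angle_spherePolar, Real.arccos_pos]
    have : 0 < Real.sin (δ * √κ) ^ 2 * y ^ 2 := by positivity
    nlinarith [Real.sin_sq_add_cos_sq (δ * √κ)]

theorem cosh_sub_mul_sinh_pos (r x y : ℝ) (h : x ^ 2 + y ^ 2 = 1) :
    0 < Real.cosh r - x * Real.sinh r := by
  have h1 := Real.cosh_sq r
  have h2 := Real.cosh_pos r
  have h3 : (x * Real.sinh r) ^ 2 < Real.cosh r ^ 2 := by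
    nlinarith [mul_nonneg (sq_nonneg y) (sq_nonneg (Real.sinh r))]
  have := abs_lt_of_sq_lt_sq h3 h2.le
  linarith [(abs_lt.1 this).2]

/-- The point of the upper half-plane with polar coordinates `r` (distance from `i`) and
`(x, y)` (direction), that is, with coordinates `(cosh r, x sinh r, y sinh r)` in the
hyperboloid model. -/
noncomputable def hyperbolicPolar (r x y : ℝ) (h : x ^ 2 + y ^ 2 = 1) : ℍ :=
  ⟨⟨y * Real.sinh r / (Real.cosh r - x * Real.sinh r), 1 / (Real.cosh r - x * Real.sinh r)⟩,
    one_div_pos.2 (cosh_sub_mul_sinh_pos r x y h)⟩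

/-- The hyperbolic law of cosines. -/
theorem cosh_dist_hyperbolicPolar (r x y r' x' y' : ℝ) (h : x ^ 2 + y ^ 2 = 1)
    (h' : x' ^ 2 + y' ^ 2 = 1) :
    Real.cosh (dist (hyperbolicPolar r x y h) (hyperbolicPolar r' x' y' h')) =
      Real.cosh r * Real.cosh r' - Real.sinh r * Real.sinh r' * (x * x' + y * y') := by
  have h1 := cosh_sub_mul_sinh_pos r x y h
  have h2 := cosh_sub_mul_sinh_pos r' x' y' h'
  have e1 := Real.cosh_sq r
  have e2 := Real.cosh_sq r'
  rw [UpperHalfPlane.cosh_dist, Complex.dist_eq, ← Complex.normSq_eq_norm_sq, Complex.normSq_apply]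
  simp only [hyperbolicPolar, UpperHalfPlane.im, Complex.sub_re, Complex.sub_im]
  set C := Real.cosh r
  set S := Real.sinh r
  set C' := Real.cosh r'
  set S' := Real.sinh r'
  have k1 : 1 + y ^ 2 * S ^ 2 = (C - x * S) * (C + x * S) := by
    linear_combination S ^ 2 * h - e1
  have k2 : 1 + y' ^ 2 * S' ^ 2 = (C' - x' * S') * (C' + x' * S') := by
    linear_combination S' ^ 2 * h' - e2
  have k3 : C + x * S = (1 + y ^ 2 * S ^ 2) / (C - x * S) := by field_simp; linarith
  have k4 : C' + x' * S' = (1 + y' ^ 2 * S' ^ 2) / (C' - x' * S') := by field_simp; linarith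
  have k5 : C * C' - S * S' * (x * x' + y * y') =
      ((C' - x' * S') * (C + x * S) + (C - x * S) * (C' + x' * S')) / 2 - y * y' * S * S' := by
    ring
  rw [k5, k3, k4]
  generalize C - x * S = D at *
  generalize C' - x' * S' = D' at *
  field_simp
  ring

theorem hyperbolicDist_hyperbolicPolar {κ d : ℝ} (hκ : κ < 0) {r x y r' x' y' : ℝ}
    (h : x ^ 2 + y ^ 2 = 1) (h' : x' ^ 2 + y' ^ 2 = 1) (hd : 0 ≤ d)
    (e : Real.cosh r * Real.cosh r' - Real.sinh r * Real.sinh r' * (x * x' + y * y') =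
      Real.cosh (d * √(-κ))) :
    hyperbolicDist κ (hyperbolicPolar r x y h) (hyperbolicPolar r' x' y' h') = d := by
  have hs : 0 < √(-κ) := Real.sqrt_pos.2 (by linarith)
  have h1 : dist (hyperbolicPolar r x y h) (hyperbolicPolar r' x' y' h') = d * √(-κ) := by
    refine Real.cosh_strictMonoOn.injOn dist_nonneg (by exact (by positivity : 0 ≤ d * √(-κ))) ?_
    rw [cosh_dist_hyperbolicPolar, e]
  rw [hyperbolicDist, h1]
  field_simp

theorem hasSeparatedMidpoints_hyperbolic {κ δ : ℝ} (hκ : κ < 0) (hδ : 0 < δ) :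
    HasSeparatedMidpoints (hyperbolicDist κ) δ := by
  intro c hc hcδ
  have hs : 0 < √(-κ) := Real.sqrt_pos.2 (by linarith)
  have hδs : 0 < δ * √(-κ) := by positivity
  have hcs : 0 < c * √(-κ) := by positivity
  have hcs' : c * √(-κ) ≤ 2 * δ * √(-κ) := by gcongr
  have hsin : 0 < Real.sinh (2 * δ * √(-κ)) := Real.sinh_pos_iff.2 (by linarith)
  have hsin1 : 0 < Real.sinh (δ * √(-κ)) := Real.sinh_pos_iff.2 hδs
  have hsinc : 0 < Real.sinh (c * √(-κ) / 2) := Real.sinh_pos_iff.2 (by linarith)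
  have hle : Real.sinh (c * √(-κ) / 2) ≤ Real.sinh (2 * δ * √(-κ)) :=
    Real.sinh_le_sinh.2 (by linarith)
  -- half of the triangle is right-angled, which determines its angle at `q`
  obtain ⟨y, hy0, hy1, hy⟩ : ∃ y : ℝ, 0 < y ∧ y ≤ 1 ∧
      y * Real.sinh (2 * δ * √(-κ)) = Real.sinh (c * √(-κ) / 2) :=
    ⟨Real.sinh (c * √(-κ) / 2) / Real.sinh (2 * δ * √(-κ)), by positivity, (div_le_one hsin).2 hle,
      div_mul_cancel₀ _ hsin.ne'⟩
  obtain ⟨x, hx⟩ : ∃ x : ℝ, x ^ 2 = 1 - y ^ 2 := ⟨√(1 - y ^ 2), Real.sq_sqrt (by nlinarith)⟩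
  have hxy : x ^ 2 + y ^ 2 = 1 := by linarith
  have hxy' : x ^ 2 + (-y) ^ 2 = 1 := by linarith
  have h10 : (1 : ℝ) ^ 2 + 0 ^ 2 = 1 := by norm_num
  have hdir : x * x + y * y = 1 := by linarith
  have hdir' : x * x + -y * -y = 1 := by linarith
  have htwo : 2 * δ * √(-κ) = δ * √(-κ) + δ * √(-κ) := by ring
  refine ⟨hyperbolicPolar 0 1 0 h10, hyperbolicPolar (2 * δ * √(-κ)) x y hxy,
    hyperbolicPolar (2 * δ * √(-κ)) x (-y) hxy', hyperbolicPolar (δ * √(-κ)) x y hxy,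
    hyperbolicPolar (δ * √(-κ)) x (-y) hxy', ?_, ?_, ?_, ?_, ?_, ?_, ?_, ?_⟩
  · exact hyperbolicDist_hyperbolicPolar hκ _ _ (by linarith) (by simp)
  · exact hyperbolicDist_hyperbolicPolar hκ _ _ (by linarith) (by simp)
  · refine hyperbolicDist_hyperbolicPolar hκ _ _ hc.le ?_
    have h2 : Real.cosh (c * √(-κ)) = 1 + 2 * Real.sinh (c * √(-κ) / 2) ^ 2 := by
      rw [show c * √(-κ) = 2 * (c * √(-κ) / 2) by ring, Real.cosh_two_mul, Real.cosh_sq]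
      ring_nf
    rw [h2, ← hy]
    linear_combination Real.cosh_sq (2 * δ * √(-κ)) - Real.sinh (2 * δ * √(-κ)) ^ 2 * hx
  · exact hyperbolicDist_hyperbolicPolar hκ _ _ hδ.le (by simp)
  · refine hyperbolicDist_hyperbolicPolar hκ _ _ hδ.le ?_
    rw [hdir, mul_one, htwo, ← Real.cosh_sub]
    rw [sub_add_cancel_left, Real.cosh_neg]
  · exact hyperbolicDist_hyperbolicPolar hκ _ _ hδ.le (by simp)
  · refine hyperbolicDist_hyperbolicPolar hκ _ _ hδ.le ?_
    rw [hdir', mul_one, htwo, ← Real.cosh_sub]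
    rw [sub_add_cancel_left, Real.cosh_neg]
  · refine div_pos ?_ hs
    have : 0 < Real.sinh (δ * √(-κ)) ^ 2 * y ^ 2 := by positivity
    refine lt_of_le_of_ne dist_nonneg (Ne.symm (Real.one_lt_cosh.1 ?_))
    rw [cosh_dist_hyperbolicPolar]
    nlinarith [Real.cosh_sq (δ * √(-κ))]

variable {X : Type*} [MetricSpace X]

/-! ### Geodesics and segments -/

namespace IsGeodesic

variable {γ : ℝ → X} {l : ℝ} {x y : X}

theorem length_eq (h : IsGeodesic γ l x y) : l = dist x y := by
  have := h.dist_eq 0 ⟨le_rfl, h.length_nonneg⟩ l ⟨h.length_nonneg, le_rfl⟩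
  rwa [h.map_zero, h.map_length, zero_sub, abs_neg, abs_of_nonneg h.length_nonneg, eq_comm] at this

theorem continuousOn (h : IsGeodesic γ l x y) : ContinuousOn γ (Set.Icc 0 l) := by
  refine (LipschitzOnWith.of_dist_le_mul (K := 1) fun s hs t ht => ?_).continuousOn
  rw [h.dist_eq s hs t ht, Real.dist_eq, NNReal.coe_one, one_mul]

theorem dist_left (h : IsGeodesic γ l x y) {t : ℝ} (ht : t ∈ Set.Icc 0 l) : dist x (γ t) = t := by
  rw [← h.map_zero, h.dist_eq 0 ⟨le_rfl, h.length_nonneg⟩ t ht, zero_sub, abs_neg,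
    abs_of_nonneg ht.1]

theorem dist_right (h : IsGeodesic γ l x y) {t : ℝ} (ht : t ∈ Set.Icc 0 l) :
    dist (γ t) y = l - t := by
  rw [← h.map_length, h.dist_eq t ht l ⟨h.length_nonneg, le_rfl⟩, abs_sub_comm,
    abs_of_nonneg (by linarith [ht.2])]

theorem injOn (h : IsGeodesic γ l x y) : Set.InjOn γ (Set.Icc 0 l) := by
  intro s hs t ht e
  have := h.dist_eq s hs t ht
  rw [e, dist_self, eq_comm, abs_eq_zero] at this
  linarith

theorem restrict (h : IsGeodesic γ l x y) {a b : ℝ} (ha : 0 ≤ a) (hab : a ≤ b) (hb : b ≤ l) :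
    IsGeodesic (fun t => γ (a + t)) (b - a) (γ a) (γ b) where
  length_nonneg := by linarith
  map_zero := by simp
  map_length := by simp
  dist_eq s hs t ht := by
    rw [h.dist_eq _ ⟨by linarith [hs.1], by linarith [hs.2]⟩ _
      ⟨by linarith [ht.1], by linarith [ht.2]⟩, add_sub_add_left_eq_sub]

theorem reverse (h : IsGeodesic γ l x y) : IsGeodesic (fun t => γ (l - t)) l y x where
  length_nonneg := h.length_nonneg
  map_zero := by simp [h.map_length]
  map_length := by simp [h.map_zero]
  dist_eq s hs t ht := by
    rw [h.dist_eq _ ⟨by linarith [hs.2], by linarith [hs.1]⟩ _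
      ⟨by linarith [ht.2], by linarith [ht.1]⟩, sub_sub_sub_cancel_left, abs_sub_comm]

theorem image_reverse {Y : Type*} (γ : ℝ → Y) (l : ℝ) :
    (fun t => γ (l - t)) '' Set.Icc 0 l = γ '' Set.Icc 0 l := by
  rw [show (fun t => γ (l - t)) = γ ∘ fun t => l - t from rfl, Set.image_comp,
    Set.image_const_sub_Icc, sub_self, sub_zero]

theorem segment_eq (hX : IsUniquelyGeodesicSpace X) (h : IsGeodesic γ l x y) :
    segment x y = γ '' Set.Icc 0 l := by
  refine Set.Subset.antisymm ?_ fun z hz => ⟨_, ⟨γ, l, h, rfl⟩, hz⟩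
  rintro z ⟨S, ⟨γ', l', h', rfl⟩, hz⟩
  obtain rfl : l' = l := h'.length_eq.trans h.length_eq.symm
  rwa [(hX.2 x y _ γ' γ h' h).image_eq] at hz

end IsGeodesic

theorem dist_add_dist_of_mem_segment {x y z : X} (hz : z ∈ segment x y) :
    dist x z + dist z y = dist x y := by
  obtain ⟨S, ⟨γ, l, h, rfl⟩, t, ht, rfl⟩ := hz
  rw [h.dist_left ht, h.dist_right ht, ← h.length_eq]
  ring

/-! ### Geodesics do not branch -/

/-- The reverse `CAT` inequality forbids a geodesic to branch at its midpoint: the comparison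
triangle of two distinct branches would have two legs with distinct midpoints. -/
theorem SatisfiesReverseCAT.not_branching {M : Type*} {dM : M → M → ℝ}
    (hself : ∀ p, dM p p = 0) (hsymm : ∀ p q, dM p q = dM q p) {δ : ℝ}
    (hM : HasSeparatedMidpoints dM δ) {T : GeodesicTriangle X} (hT : SatisfiesReverseCAT dM T)
    (h1 : dist (T.vertex 0) (T.vertex 1) = 2 * δ) (h2 : dist (T.vertex 0) (T.vertex 2) = 2 * δ)
    {m : X} (hm1 : m ∈ T.side 1) (hm2 : m ∈ T.side 2) (hm : dist (T.vertex 0) m = δ)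
    (hm1' : dist m (T.vertex 1) = δ) (hm2' : dist m (T.vertex 2) = δ) :
    T.vertex 1 = T.vertex 2 := by
  by_contra hne
  obtain ⟨q, p, p', n, n', e1, e2, e3, e4, e5, e6, e7, hpos⟩ :=
    hM (dist (T.vertex 1) (T.vertex 2)) (dist_pos.2 hne) (by
      have := dist_triangle_left (T.vertex 1) (T.vertex 2) m
      linarith)
  have hq : IsComparisonTriangle dM T ![q, p, p'] := by
    intro i j
    fin_cases i <;> fin_cases j <;>
      simp [hself, e1, e2, e3, h1, h2, hsymm p q, hsymm p' q, hsymm p' p,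
        dist_comm (T.vertex 1) (T.vertex 0), dist_comm (T.vertex 2) (T.vertex 0),
        dist_comm (T.vertex 2) (T.vertex 1)]
  have := hT _ hq 2 1 m hm2 m hm1 n n' ⟨by simpa [hm] using e4, by simpa [hm1'] using e5⟩
    ⟨by simpa [dist_comm _ m, hm2', hsymm p'] using e7,
      by simpa [dist_comm m, hm, hsymm n'] using e6⟩
  rw [dist_self] at this
  linarith

/-- Short geodesics do not branch at their midpoint. The bound on the length keeps the perimeter
of the triangles below twice the diameter of the model plane and, for `κ > 0`, the legs within a
quarter of a great circle. -/
theorem CurvatureBoundedBelowBy.exists_not_branching_of_length {κ : ℝ}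
    (hκ : CurvatureBoundedBelowBy X κ) :
    ∃ δ₀ : ℝ, 0 < δ₀ ∧ ∀ δ : ℝ, 0 < δ → δ ≤ δ₀ → ∀ (q p p' : X) (γ γ' : ℝ → X),
      IsGeodesic γ (2 * δ) q p → IsGeodesic γ' (2 * δ) q p' → γ δ = γ' δ → p = p' := by
  obtain ⟨hgeo, hκ⟩ := hκ
  -- the triangles below have legs `2 * δ` and base at most `2 * δ`
  obtain ⟨δ₀, hδ₀, hper, hsph⟩ : ∃ δ₀ : ℝ, 0 < δ₀ ∧
      (∀ δ ≤ δ₀, ENNReal.ofReal (6 * δ) < 2 * modelDiam κ) ∧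
      (0 < κ → ∀ δ ≤ δ₀, 2 * δ * √κ ≤ Real.pi / 2) := by
    rcases le_or_gt κ 0 with h | h
    · refine ⟨1, one_pos, fun δ _ => ?_, fun h' => absurd h' h.not_gt⟩
      rw [modelDiam, if_pos h, ENNReal.mul_top two_ne_zero]
      exact ENNReal.ofReal_lt_top
    · have hs : 0 < √κ := Real.sqrt_pos.2 h
      have hπ := Real.pi_pos
      refine ⟨Real.pi / (4 * √κ), by positivity, fun δ hδ => ?_, fun _ δ hδ => ?_⟩
      · rw [modelDiam, if_neg h.not_ge, show (2 : ENNReal) = ENNReal.ofReal 2 by simp,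
          ← ENNReal.ofReal_mul (by norm_num), ENNReal.ofReal_lt_ofReal_iff (by positivity)]
        calc 6 * δ ≤ 6 * (Real.pi / (4 * √κ)) := by gcongr
          _ = (3 / 2) * (Real.pi / √κ) := by field_simp; norm_num
          _ < 2 * (Real.pi / √κ) := by gcongr; norm_num
      · rw [le_div_iff₀ (by positivity)] at hδ
        linarith
  refine ⟨δ₀, hδ₀, fun δ hδ hδ' q p p' γ γ' hγ hγ' hm => ?_⟩
  obtain ⟨σ, l, hσ⟩ := hgeo p p'
  have hmem : δ ∈ Set.Icc 0 (2 * δ) := ⟨hδ.le, by linarith⟩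
  have hleg := hγ.length_eq
  have hleg' := hγ'.length_eq
  have d0 := hγ.dist_left hmem
  have d1 := hγ.dist_right hmem
  have d2 := hγ'.dist_right hmem
  rw [← hm] at d2
  let T : GeodesicTriangle X :=
    { vertex := ![q, p, p']
      side := ![σ '' Set.Icc 0 l, γ' '' Set.Icc 0 (2 * δ), γ '' Set.Icc 0 (2 * δ)]
      isSegment := by
        intro i
        fin_cases i
        · exact ⟨σ, l, hσ, rfl⟩
        · exact ⟨_, _, hγ'.reverse, (IsGeodesic.image_reverse _ _).symm⟩
        · exact ⟨γ, _, hγ, rfl⟩ }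
  have hTper : T.perimeter ≤ 6 * δ := by
    have := dist_triangle_left p p' (γ δ)
    have e : T.perimeter = dist p p' + dist p' q + dist q p := by
      simp [GeodesicTriangle.perimeter, Fin.sum_univ_three, T]
    rw [e, dist_comm p' q, ← hleg, ← hleg']
    linarith
  obtain ⟨hneg, hzero, hpos⟩ :=
    hκ T ((ENNReal.ofReal_le_ofReal hTper).trans_lt (hper δ hδ'))
  have main : ∀ {M : Type} {dM : M → M → ℝ}, (∀ p, dM p p = 0) → (∀ p q, dM p q = dM q p) →
      HasSeparatedMidpoints dM δ → SatisfiesReverseCAT dM T → p = p' := by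
    intro M dM hself hsymm hM hT
    exact hT.not_branching hself hsymm hM hleg.symm hleg'.symm
      (m := γ δ) ⟨δ, hmem, hm.symm⟩ ⟨δ, hmem, rfl⟩ d0 (by
        change dist (γ δ) p = δ
        linarith) (by
        change dist (γ δ) p' = δ
        linarith)
  rcases lt_trichotomy κ 0 with h | h | h
  · exact main (fun p => by simp [hyperbolicDist]) (fun p q => by simp [hyperbolicDist, dist_comm])
      (hasSeparatedMidpoints_hyperbolic h hδ) (hneg h)
  · exact main (fun p => dist_self p) (fun p q => dist_comm p q)
      (hasSeparatedMidpoints_euclidean hδ) (hzero h)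
  · refine main (fun p => ?_) (fun p q => by simp [sphereDist, InnerProductGeometry.angle_comm])
      (hasSeparatedMidpoints_sphere h hδ (hsph h δ hδ')) (hpos h)
    rw [sphereDist, InnerProductGeometry.angle_self (ne_zero_of_mem_unit_sphere p), zero_div]

/-- Geodesics in a uniquely geodesic space of curvature bounded below do not branch. -/
theorem IsGeodesic.eq_of_eq (hX : IsUniquelyGeodesicSpace X) (hcurv : CurvatureBoundedBelow X)
    {γ γ' : ℝ → X} {l l' r : ℝ} {q p p' : X} (h : IsGeodesic γ l q p) (h' : IsGeodesic γ' l' q p')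
    (hr : 0 < r) (hrl : r ≤ l) (hll' : l ≤ l') (e : γ r = γ' r) : γ l = γ' l := by
  obtain ⟨κ, hκ⟩ := hcurv
  obtain ⟨δ₀, hδ₀, hloc⟩ := hκ.exists_not_branching_of_length
  have hl : 0 ≤ l := h.length_nonneg
  -- the largest parameter at which the two geodesics agree
  obtain ⟨s, ⟨hs, hse⟩, hmax⟩ : ∃ s, IsGreatest {s | s ∈ Set.Icc 0 l ∧ γ s = γ' s} s := by
    refine IsCompact.exists_isGreatest ?_ ⟨r, ⟨hr.le, hrl⟩, e⟩
    refine isCompact_Icc.of_isClosed_subset ?_ (fun s hs => hs.1)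
    exact (h.continuousOn.prodMk
      (h'.continuousOn.mono (Set.Icc_subset_Icc_right hll'))).preimage_isClosed_of_isClosed
        isClosed_Icc isClosed_diagonal
  have hrs : r ≤ s := hmax ⟨⟨hr.le, hrl⟩, e⟩
  rcases hs.2.eq_or_lt with rfl | hsl
  · exact hse
  exfalso
  obtain ⟨δ, hδ, hδ₁, hδ₂, hδ₃⟩ : ∃ δ : ℝ, 0 < δ ∧ δ ≤ δ₀ ∧ δ ≤ s ∧ δ ≤ l - s :=
    ⟨min δ₀ (min s (l - s)), lt_min hδ₀ (lt_min (hr.trans_le hrs) (by linarith)), min_le_left _ _,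
      (min_le_right _ _).trans (min_le_left _ _), (min_le_right _ _).trans (min_le_right _ _)⟩
  -- by uniqueness, the geodesics agree up to the parameter `s`
  have hbefore : γ (s - δ) = γ' (s - δ) := by
    have g := h.restrict le_rfl hs.1 hs.2
    have g' := h'.restrict le_rfl hs.1 (hs.2.trans hll')
    rw [h.map_zero] at g
    rw [h'.map_zero, ← hse] at g'
    have := hX.2 _ _ _ _ _ g g'
      (show s - δ ∈ Set.Icc 0 (s - 0) from ⟨by linarith, by linarith⟩)
    simpa using this
  have g := h.restrict (a := s - δ) (b := s + δ) (by linarith) (by linarith) (by linarith)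
  have g' := h'.restrict (a := s - δ) (b := s + δ) (by linarith) (by linarith) (by linarith)
  rw [show s + δ - (s - δ) = 2 * δ by ring] at g g'
  rw [← hbefore] at g'
  have := hloc δ hδ hδ₁ _ _ _ _ _ g g' (by simpa using hse)
  have := hmax ⟨⟨by linarith, by linarith⟩, this⟩
  linarith

/-- Two sides of a triangle whose third side is the longest meet in their common vertex only. -/
theorem eq_of_mem_segment_of_mem_segment (hX : IsUniquelyGeodesicSpace X)
    (hcurv : CurvatureBoundedBelow X) {p q s z : X} (h1 : dist p q < dist p s)
    (h2 : dist q s < dist p s) (hz1 : z ∈ segment p q) (hz2 : z ∈ segment q s) : z = q := by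
  by_contra hne
  obtain ⟨-, ⟨γ, l, h, rfl⟩, hz1⟩ := hz1
  obtain ⟨-, ⟨γ', l', h', rfl⟩, t', ht', e'⟩ := hz2
  rw [← IsGeodesic.image_reverse] at hz1
  obtain ⟨t, ht, e⟩ := hz1
  replace h := h.reverse
  set σ := fun t => γ (l - t)
  obtain rfl : t = t' := by
    rw [← h.dist_left ht, ← h'.dist_left ht', e, e']
  have hpos : 0 < t := by
    refine lt_of_le_of_ne ht.1 fun h0 => hne ?_
    rw [← e, ← h0, h.map_zero]
  have hl := h.length_eq
  have hl' := h'.length_eq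
  rw [dist_comm] at hl
  rcases le_total l l' with hll | hll
  · have := h.eq_of_eq hX hcurv h' hpos ht.2 hll (e.trans e'.symm)
    have d := h'.dist_right ⟨h.length_nonneg, hll⟩
    rw [← this, h.map_length] at d
    linarith [h.length_nonneg]
  · have := h'.eq_of_eq hX hcurv h hpos ht'.2 hll (e'.trans e.symm)
    have d := h.dist_right ⟨h'.length_nonneg, hll⟩
    rw [← this, h'.map_length, dist_comm] at d
    linarith [h'.length_nonneg]

/-! ### Chains of segments -/

/-- A locally finite chain of nondegenerate segments is a polygonal ray if consecutive ones meet in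
their common endpoint only and the others are disjoint. -/
theorem isPolygonalRay_iUnion_segment (hX : IsUniquelyGeodesicSpace X) {a : ℕ → X}
    (hne : ∀ n, a n ≠ a (n + 1))
    (hadj : ∀ n, ∀ z ∈ segment (a n) (a (n + 1)), z ∈ segment (a (n + 1)) (a (n + 2)) →
      z = a (n + 1))
    (hdisj : ∀ i j, i + 1 < j →
      Disjoint (segment (a i) (a (i + 1))) (segment (a j) (a (j + 1))))
    (hlf : LocallyFinite fun n => segment (a n) (a (n + 1))) :
    IsPolygonalRay (⋃ n, segment (a n) (a (n + 1))) := by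
  choose γ l hγ using fun n => hX.1 (a n) (a (n + 1))
  have hseg : ∀ n, segment (a n) (a (n + 1)) = γ n '' Set.Icc 0 (l n) :=
    fun n => (hγ n).segment_eq hX
  have hl : ∀ n, 0 < l n := fun n => by
    rw [(hγ n).length_eq]
    exact dist_pos.2 (hne n)
  -- `f` runs through the `n`-th segment with constant speed on `[n, n + 1]`
  let f : Set.Ici (0 : ℝ) → X := fun t => γ ⌊(t : ℝ)⌋₊ (l ⌊(t : ℝ)⌋₊ * (t - ⌊(t : ℝ)⌋₊))
  let I : ℕ → Set (Set.Ici (0 : ℝ)) := fun n => {t | (t : ℝ) ∈ Set.Icc (n : ℝ) (n + 1)}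
  have hpar : ∀ n, ∀ t ∈ I n, l n * ((t : ℝ) - n) ∈ Set.Icc 0 (l n) := fun n t ht =>
    ⟨mul_nonneg (hl n).le (by linarith [ht.1]),
      mul_le_of_le_one_right (hl n).le (by linarith [ht.2])⟩
  have hf : ∀ n, ∀ t ∈ I n, f t = γ n (l n * (t - n)) := by
    intro n t ht
    rcases ht.2.eq_or_lt with h | h
    · have hfl : ⌊(t : ℝ)⌋₊ = n + 1 := by
        rw [h]
        exact_mod_cast Nat.floor_natCast (R := ℝ) (n + 1)
      simp only [f, hfl]
      rw [h]
      push_cast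
      rw [sub_self, mul_zero, (hγ (n + 1)).map_zero, add_sub_cancel_left, mul_one,
        (hγ n).map_length]
    · have hfl : ⌊(t : ℝ)⌋₊ = n := (Nat.floor_eq_iff t.2).2 ⟨ht.1, h⟩
      simp only [f, hfl]
  have hfloor : ∀ t : Set.Ici (0 : ℝ), t ∈ I ⌊(t : ℝ)⌋₊ := fun t =>
    ⟨Nat.floor_le t.2, (Nat.lt_floor_add_one _).le⟩
  have hcover : ⋃ n, I n = Set.univ :=
    Set.eq_univ_of_forall fun t => Set.mem_iUnion.2 ⟨_, hfloor t⟩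
  have himage : ∀ n, f '' I n = segment (a n) (a (n + 1)) := by
    intro n
    rw [hseg]
    ext z
    constructor
    · rintro ⟨t, ht, rfl⟩
      exact ⟨_, hpar n t ht, (hf n t ht).symm⟩
    · rintro ⟨s, hs, rfl⟩
      have h0 : 0 ≤ s / l n := div_nonneg hs.1 (hl n).le
      have h1 : s / l n ≤ 1 := (div_le_one (hl n)).2 hs.2
      have hn : (0 : ℝ) ≤ n := n.cast_nonneg
      let t : Set.Ici (0 : ℝ) := ⟨n + s / l n, by
        rw [Set.mem_Ici]
        positivity⟩
      have ht : t ∈ I n := ⟨by simp [t, h0], by simp [t, h1]⟩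
      refine ⟨t, ht, ?_⟩
      rw [hf n t ht]
      congr 1
      simp only [t]
      field_simp [(hl n).ne']
      ring
  have hIlf : LocallyFinite I := by
    intro x
    refine ⟨{t | (t : ℝ) < x + 1}, (isOpen_Iio.preimage continuous_subtype_val).mem_nhds
      (by simp), (Set.finite_le_nat ⌊(x : ℝ) + 1⌋₊).subset ?_⟩
    rintro n ⟨t, ht, htx⟩
    exact Nat.le_floor (ht.1.trans (le_of_lt htx))
  have hIclosed : ∀ n, IsClosed (I n) := fun n => isClosed_Icc.preimage continuous_subtype_val
  have hIcompact : ∀ n, IsCompact (I n) := fun n =>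
    isClosed_Ici.isClosedEmbedding_subtypeVal.isCompact_preimage isCompact_Icc
  have hcont : ∀ n, ContinuousOn f (I n) := by
    intro n
    refine ContinuousOn.congr ?_ (hf n)
    exact (hγ n).continuousOn.comp (by fun_prop) (hpar n)
  have hfcont : Continuous f := hIlf.continuous hcover hIclosed hcont
  have hinj : ∀ s t, s ≤ t → f s = f t → s = t := by
    intro s t hst e
    have hs := hfloor s
    have ht := hfloor t
    have hij : ⌊(s : ℝ)⌋₊ ≤ ⌊(t : ℝ)⌋₊ := Nat.floor_mono hst
    generalize ⌊(s : ℝ)⌋₊ = i at hs hij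
    generalize ⌊(t : ℝ)⌋₊ = j at ht hij
    have hsi : f s ∈ segment (a i) (a (i + 1)) := himage i ▸ Set.mem_image_of_mem f hs
    have htj : f t ∈ segment (a j) (a (j + 1)) := himage j ▸ Set.mem_image_of_mem f ht
    rcases hij.eq_or_lt with rfl | hlt
    · rw [hf i s hs, hf i t ht] at e
      have := mul_left_cancel₀ (hl i).ne' ((hγ i).injOn (hpar i s hs) (hpar i t ht) e)
      exact Subtype.ext (by linarith)
    rcases (Nat.succ_le_of_lt hlt).eq_or_lt with rfl | hlt
    · have hz := hadj i (f s) hsi (e ▸ htj)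
      have hz' := e ▸ hz
      rw [hf i s hs, ← (hγ i).map_length] at hz
      rw [hf _ t ht, ← (hγ (i + 1)).map_zero] at hz'
      have h1 := (hγ i).injOn (hpar i s hs) ⟨(hl i).le, le_rfl⟩ hz
      have h2 := (hγ (i + 1)).injOn (hpar (i + 1) t ht) ⟨le_rfl, (hl (i + 1)).le⟩ hz'
      have h3 := (mul_eq_left₀ (hl i).ne').1 h1
      have h4 := (mul_eq_zero.1 h2).resolve_left (hl (i + 1)).ne'
      push_cast at h4
      exact Subtype.ext (by linarith)
    · exact absurd (e ▸ htj) (Set.disjoint_left.1 (hdisj i j hlt) hsi)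
  have hfinj : Function.Injective f := fun s t e =>
    (le_total s t).elim (fun h => hinj s t h e) fun h => (hinj t s h e.symm).symm
  have hfclosed : IsClosedMap f := by
    intro C hC
    rw [← Set.inter_univ C, ← hcover, Set.inter_iUnion, Set.image_iUnion]
    refine LocallyFinite.isClosed_iUnion (hlf.subset fun n => ?_) fun n =>
      (((hIcompact n).inter_left hC).image hfcont).isClosed
    rw [← himage]
    exact Set.image_mono Set.inter_subset_right
  have hemb := Topology.IsClosedEmbedding.of_continuous_injective_isClosedMap hfcont hfinj hfclosed
  have hrange : ⋃ n, segment (a n) (a (n + 1)) = Set.range f := by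
    simp_rw [← himage]
    rw [← Set.image_iUnion, hcover, Set.image_univ]
  rw [hrange]
  refine ⟨hemb.isClosed_range, hemb.isEmbedding.toHomeomorph, fun n => n, by simp,
    Nat.strictMono_cast, ?_, fun n => ⟨a n, a (n + 1), γ n, l n, hγ n, ?_⟩⟩
  · rintro ⟨B, hB⟩
    obtain ⟨n, hn⟩ := exists_nat_gt B
    exact hn.not_ge (hB ⟨n, rfl⟩)
  · rw [← hseg, ← himage]
    push_cast
    rfl

/-! ### Greedy subdivision of a closed ray -/

/-- A gauge for a closed ray `g`: beyond the time `s + 2`, the ray stays away from `g s`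
by more than `ρ s`. -/
theorem exists_antitone_gauge {g : ℝ → X} (hg : Continuous g) (hinj : Set.InjOn g (Set.Ici 0))
    (hclosed : ∀ t, 0 ≤ t → IsClosed (g '' Set.Ici t)) :
    ∃ ρ : ℝ → ℝ, Antitone ρ ∧ (∀ t, 0 < ρ t) ∧ Tendsto ρ atTop (𝓝 0) ∧
      ∀ s u, 0 ≤ s → s + 2 ≤ u → ρ s < dist (g s) (g u) := by
  have hsep : ∀ k : ℕ, ∃ c : ℝ, 0 < c ∧ ∀ s ∈ Set.Icc (0 : ℝ) (k + 1), ∀ u, (k : ℝ) + 2 ≤ u →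
      c < dist (g s) (g u) := by
    intro k
    have hk : (0 : ℝ) ≤ k := k.cast_nonneg
    have hd : Disjoint (g '' Set.Icc (0 : ℝ) (k + 1)) (g '' Set.Ici ((k : ℝ) + 2)) := by
      rw [Set.disjoint_left]
      rintro _ ⟨s, hs, rfl⟩ ⟨u, hu, e⟩
      rw [Set.mem_Ici] at hu
      have := hinj (Set.mem_Ici.2 (by linarith)) hs.1 e
      linarith [hs.2]
    obtain ⟨c, hc, hd⟩ := hd.exists_cthickenings (isCompact_Icc.image hg)
      (hclosed _ (by positivity))
    refine ⟨c, hc, fun s hs u hu => lt_of_not_ge fun h => ?_⟩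
    rw [dist_comm] at h
    exact Set.disjoint_left.1 hd
      (Metric.mem_cthickening_of_dist_le _ _ _ _ (Set.mem_image_of_mem g hs) h)
      (Metric.self_subset_cthickening _ (Set.mem_image_of_mem g hu))
  choose c hc hsep using hsep
  let r : ℕ → ℝ := fun n =>
    (Finset.range (n + 1)).inf' Finset.nonempty_range_add_one fun k => min (c k) (1 / (k + 1))
  have hr0 : ∀ n, 0 < r n := fun n =>
    (Finset.lt_inf'_iff _).2 fun k _ => lt_min (hc k) (by positivity)
  have hrle : ∀ n, r n ≤ min (c n) (1 / (n + 1)) := fun n =>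
    Finset.inf'_le (fun k : ℕ => min (c k) (1 / ((k : ℝ) + 1))) (Finset.self_mem_range_succ n)
  have hranti : Antitone r := fun m n h =>
    Finset.inf'_mono _ (Finset.range_mono (by omega)) _
  refine ⟨fun t => r ⌊t⌋₊, fun s t h => hranti (Nat.floor_mono h), fun t => hr0 _, ?_, ?_⟩
  · have hr : Tendsto r atTop (𝓝 0) :=
      squeeze_zero (fun n => (hr0 n).le) (fun n => (hrle n).trans (min_le_right _ _))
        tendsto_one_div_add_atTop_nhds_zero_nat
    exact hr.comp tendsto_nat_floor_atTop
  · intro s u hs hu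
    refine ((hrle _).trans (min_le_left _ _)).trans_lt (hsep _ s ⟨hs, ?_⟩ u ?_)
    · exact (Nat.lt_floor_add_one s).le
    · linarith [Nat.floor_le hs]

/-- The greedy subdivision of a closed ray: the next vertex is the last point of the ray which is
within the gauge of the current one. -/
theorem exists_greedy_subdivision {g : ℝ → X} (hg : Continuous g) {ρ : ℝ → ℝ} (hanti : Antitone ρ)
    (hpos : ∀ t, 0 < ρ t) (hρ : ∀ s u, 0 ≤ s → s + 2 ≤ u → ρ s < dist (g s) (g u)) :
    ∃ τ : ℕ → ℝ, (∀ n, 0 ≤ τ n) ∧ StrictMono τ ∧ Tendsto τ atTop atTop ∧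
      (∀ n, dist (g (τ n)) (g (τ (n + 1))) ≤ ρ (τ n)) ∧
      ∀ n u, τ (n + 1) < u → ρ (τ n) < dist (g (τ n)) (g u) := by
  have hnext : ∀ t, ∃ u, 0 ≤ t →
      t < u ∧ dist (g t) (g u) ≤ ρ t ∧ ∀ w, u < w → ρ t < dist (g t) (g w) := by
    intro t
    by_cases ht : 0 ≤ t
    swap
    · exact ⟨0, fun h => absurd h ht⟩
    have hcl : IsClosed {w | dist (g t) (g w) ≤ ρ t} :=
      isClosed_le (by fun_prop) continuous_const
    obtain ⟨u, hu, hmax⟩ := (isCompact_Icc.inter_right hcl).exists_isGreatest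
      ⟨t, ⟨le_rfl, show t ≤ t + 2 by linarith⟩, by simp [(hpos t).le]⟩
    refine ⟨u, fun _ => ⟨?_, hu.2, fun w hw => lt_of_not_ge fun h => ?_⟩⟩
    · have hev : ∀ᶠ w in 𝓝[>] t, dist (g t) (g w) < ρ t := by
        have : Tendsto (fun w => dist (g t) (g w)) (𝓝[>] t) (𝓝 (dist (g t) (g t))) :=
          (Continuous.tendsto (by fun_prop) t).mono_left nhdsWithin_le_nhds
        rw [dist_self] at this
        exact this.eventually_lt_const (hpos t)
      obtain ⟨w, hw, hw'⟩ := (hev.and (Ioo_mem_nhdsGT (show t < t + 2 by linarith))).exists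
      exact hw'.1.trans_le (hmax ⟨⟨hw'.1.le, hw'.2.le⟩, hw.le⟩)
    · rcases le_total w (t + 2) with h2 | h2
      · exact hw.not_ge (hmax ⟨⟨hu.1.1.trans hw.le, h2⟩, h⟩)
      · exact (hρ t w ht h2).not_ge h
  choose N hN using hnext
  let τ : ℕ → ℝ := fun n => N^[n] 0
  have hsucc : ∀ n, τ (n + 1) = N (τ n) := fun n => Function.iterate_succ_apply' N n 0
  have h0 : ∀ n, 0 ≤ τ n := by
    intro n
    induction n with
    | zero => exact le_rfl
    | succ n ih =>
      rw [hsucc]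
      exact ih.trans (hN _ ih).1.le
  have hmono : StrictMono τ := strictMono_nat_of_lt_succ fun n => by
    rw [hsucc]
    exact (hN _ (h0 n)).1
  have hfar : ∀ n u, τ (n + 1) < u → ρ (τ n) < dist (g (τ n)) (g u) := fun n u hu =>
    (hN _ (h0 n)).2.2 u (hsucc n ▸ hu)
  refine ⟨τ, h0, hmono, ?_, fun n => hsucc n ▸ (hN _ (h0 n)).2.1, hfar⟩
  rcases tendsto_atTop_of_monotone hmono.monotone with h | ⟨T, hT⟩
  · exact h
  -- if `τ` converged to `T`, then some point beyond `T` would be within the gauge of `g (τ n)`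
  exfalso
  have hle : ∀ n, τ n ≤ T := hmono.monotone.ge_of_tendsto hT
  obtain ⟨η, hη, hball⟩ := Metric.continuousAt_iff.1 (hg.continuousAt (x := T)) (ρ T / 2)
    (half_pos (hpos T))
  obtain ⟨n, hn⟩ := ((Metric.tendsto_atTop.1 hT η hη).imp fun n h => h n le_rfl)
  have h1 := hball hn
  have h2 := @hball (T + η / 2) (by
    rw [Real.dist_eq, add_sub_cancel_left, abs_of_pos (by linarith)]
    linarith)
  have h3 := hfar n (T + η / 2) (by linarith [hle (n + 1)])
  have h4 := dist_triangle_right (g (τ n)) (g (T + η / 2)) (g T)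
  linarith [hanti (hle n)]

/-! ### The inscribed polygonal ray -/

theorem exists_isPolygonalRay_isInscribedIn (hX : IsUniquelyGeodesicSpace X)
    (hcurv : CurvatureBoundedBelow X) {Γ : Set X} (hΓ : IsTopologicalRay Γ)
    (hclosed : IsClosed Γ) : ∃ L : Set X, IsPolygonalRay L ∧ IsInscribedIn L Γ := by
  obtain ⟨e⟩ := hΓ
  let π : ℝ → Set.Ici (0 : ℝ) := Set.projIci 0
  let g : ℝ → X := fun t => e (π t)
  have hg : Continuous g := by
    have : Continuous π := (continuous_const.max continuous_id).subtype_mk _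
    fun_prop
  have hemb : Topology.IsClosedEmbedding fun t : Set.Ici (0 : ℝ) => (e t : X) :=
    hclosed.isClosedEmbedding_subtypeVal.comp e.isClosedEmbedding
  have hπ : ∀ t, ∀ ht : 0 ≤ t, π t = ⟨t, ht⟩ := fun t ht => Set.projIci_of_mem ht
  have hinj : Set.InjOn g (Set.Ici 0) := by
    intro s hs t ht h
    have := hemb.injective h
    rw [hπ s hs, hπ t ht] at this
    exact congrArg Subtype.val this
  have hgcl : ∀ t, 0 ≤ t → IsClosed (g '' Set.Ici t) := by
    intro t ht
    have : g '' Set.Ici t =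
        (fun s : Set.Ici (0 : ℝ) => (e s : X)) '' (Subtype.val ⁻¹' Set.Ici t) := by
      ext z
      constructor
      · rintro ⟨s, hs, rfl⟩
        have hs0 : 0 ≤ s := ht.trans hs
        exact ⟨⟨s, hs0⟩, hs, by simp [g, hπ s hs0]⟩
      · rintro ⟨⟨s, hs0⟩, hs, rfl⟩
        exact ⟨s, hs, by simp [g, hπ s hs0]⟩
    rw [this]
    exact hemb.isClosedMap _ (isClosed_Ici.preimage continuous_subtype_val)
  obtain ⟨ρ, hanti, hpos, hρ0, hρ⟩ := exists_antitone_gauge hg hinj hgcl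
  obtain ⟨τ, h0, hmono, htop, hnear, hfar⟩ := exists_greedy_subdivision hg hanti hpos hρ
  have hρle : ∀ {m n}, m ≤ n → ρ (τ n) ≤ ρ (τ m) := fun h => hanti (hmono.monotone h)
  refine ⟨⋃ n, segment (g (τ n)) (g (τ (n + 1))),
    isPolygonalRay_iUnion_segment hX (a := fun n => g (τ n)) ?_ ?_ ?_ ?_,
    fun n => g (τ n), fun n => (e _).2, rfl⟩
  · exact fun n h => (hmono n.lt_succ_self).ne (hinj (h0 n) (h0 (n + 1)) h)
  · intro n z hz hz'
    have h := hfar n (τ (n + 2)) (hmono (Nat.lt_succ_self _))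
    exact eq_of_mem_segment_of_mem_segment hX hcurv ((hnear n).trans_lt h)
      (((hnear (n + 1)).trans (hρle n.le_succ)).trans_lt h) hz hz'
  · intro i j hij
    rw [Set.disjoint_left]
    intro z hz hz'
    -- uncrossing: `d(a i, a j) + d(a (i+1), a (j+1)) ≤ d(a i, a (i+1)) + d(a j, a (j+1))`
    have h1 := hfar i (τ j) (hmono hij)
    have h2 := hfar (i + 1) (τ (j + 1)) (hmono (by omega))
    have h3 := dist_add_dist_of_mem_segment hz
    have h4 := dist_add_dist_of_mem_segment hz'
    have h5 := dist_triangle_right (g (τ i)) (g (τ j)) z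
    have h6 := dist_triangle_left (g (τ (i + 1))) (g (τ (j + 1))) z
    have h7 := hρle hij.le
    linarith [hnear i, hnear j]
  · intro x
    -- the tail of the ray avoids a neighbourhood of `x`, and the segments shrink
    obtain ⟨t, ht, hxt⟩ : ∃ t, 0 ≤ t ∧ x ∉ g '' Set.Ici t := by
      by_cases hx : x ∈ g '' Set.Ici 0
      · obtain ⟨s, hs, rfl⟩ := hx
        rw [Set.mem_Ici] at hs
        refine ⟨s + 1, by linarith, ?_⟩
        rintro ⟨u, hu, h⟩
        rw [Set.mem_Ici] at hu
        have := hinj (Set.mem_Ici.2 (by linarith)) (Set.mem_Ici.2 hs) h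
        linarith
      · exact ⟨0, le_rfl, hx⟩
    obtain ⟨r, hr, hball⟩ := Metric.isOpen_iff.1 (hgcl t ht).isOpen_compl x hxt
    have hev : ∀ᶠ n in atTop, t ≤ τ n ∧ ρ (τ n) < r / 2 :=
      (htop.eventually_ge_atTop t).and ((hρ0.comp htop).eventually_lt_const (half_pos hr))
    obtain ⟨m, hm⟩ := eventually_atTop.1 hev
    refine ⟨Metric.ball x (r / 2), Metric.ball_mem_nhds x (half_pos hr),
      (Set.finite_lt_nat m).subset ?_⟩
    rintro n ⟨z, hz, hzx⟩
    by_contra hn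
    obtain ⟨hn1, hn2⟩ := hm n (not_lt.1 hn)
    refine @hball (g (τ n)) ?_ ⟨τ n, hn1, rfl⟩
    have h1 := dist_add_dist_of_mem_segment hz
    have h2 := dist_triangle (g (τ n)) z x
    rw [Metric.mem_ball] at hzx ⊢
    linarith [hnear n, dist_nonneg (x := z) (y := g (τ (n + 1)))]

end GeodesicRay

theorem proposition2p5 {X : Type*} [MetricSpace X] [CompleteSpace X]
    (hX : GeodesicRay.IsUniquelyGeodesicSpace X)
    (hcurv : GeodesicRay.CurvatureBoundedBelow X)
    (Γ : Set X) (hΓ : GeodesicRay.IsTopologicalRay Γ) (hclosed : IsClosed Γ) :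
    ∃ L : Set X, GeodesicRay.IsPolygonalRay L ∧ GeodesicRay.IsInscribedIn L Γ :=
  GeodesicRay.exists_isPolygonalRay_isInscribedIn hX hcurv hΓ hclosed
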